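/- There is an absolute constant $C_0>0$ such that the following holds for every $C\ge C_0$. Let $G$ be a simple graph on the vertex set $[n]$ with degrees $d_i$, neighbourhoods $\Gamma(i)$ and average degree $\Delta=\frac1n\sum_i d_i>0$, let $0<\varepsilon\le 1$, put $\alpha_\varepsilon=\frac{\varepsilon^4}{C\log n}$ and $q=\frac{16\log n}{\varepsilon^2\Delta}$, and assume $q<1$. Let $h_i=\min\{1,\frac{\max\{d_i,\varepsilon\Delta\}}{\Delta^2\alpha_\varepsilon}\}$ be the importance scores, let $p_i\in[h_i,2h_i]$ with $p_i\le 1$ be sampling probabilities, let $S\subseteq[n]$ be any (seed) set, and let $p_i^*=1$ for $i\in S$ and $p_i^*=\frac{p_i-q}{1-q}$ for $i\notin S$. Put $w_{ij}^*=\frac{1}{p_i^*p_j^*\Delta^2}$, and let $c_j\in[0,2]$ be fixed reals. Let $Y_1,\dots,Y_n$ be independent random variables, $Y_i$ being $1$ with probability $p_i^*$ and $0$ otherwise, and define \[ f(Y)=\sum_i Y_i\Big|\sum_{j\in\Gamma(i)}w_{ij}^*c_j(Y_j-p_j^*)\Big| . \] Call $Y$ good if $\sum_{j\in\Gamma(i)}w_{ij}^*Y_j\le\frac{\varepsilon\Delta+2d_i}{p_i^*\Delta^2}$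 for all $i\in[n]$. Then $\Pr[Y\text{ is good}]>0$ and \[ \Pr\Big[f(Y)\ge\frac{\varepsilon n}{8\Delta}\ \Big|\ Y\text{ is good}\Big]\le\frac{1}{n^5}\,e^{-20\,n\log n/(\varepsilon^2\Delta)} . \] -/

import Mathlib

open MeasureTheory ProbabilityTheory

noncomputable section

namespace CoreSet

variable {n : ℕ}

/-- The average degree `Δ` of a graph on `n` vertices. -/
def avgDegree (G : SimpleGraph (Fin n)) [DecidableRel G.Adj] : ℝ :=
  (∑ i, (G.degree i : ℝ)) / n

/-- The parameter `α_ε = ε ^ 4 / (C log n)`. -/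
def alphaParam (C ε : ℝ) (n : ℕ) : ℝ :=
  ε ^ 4 / (C * Real.log n)

/-- The importance score `h_i = min {1, max {d_i, ε Δ} / (Δ² α_ε)}`. -/
def importance (G : SimpleGraph (Fin n)) [DecidableRel G.Adj] (C ε : ℝ) (i : Fin n) : ℝ :=
  min 1 (max (G.degree i : ℝ) (ε * avgDegree G) / (avgDegree G ^ 2 * alphaParam C ε n))

/-- The uniform probability `q = 16 log n / (ε² Δ)` with which a vertex enters the seed set. -/
def seedProb (G : SimpleGraph (Fin n)) [DecidableRel G.Adj] (ε : ℝ) : ℝ :=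
  16 * Real.log n / (ε ^ 2 * avgDegree G)

/-- The probability `p*_i` that vertex `i` is sampled, given the seed set `S`: it is `1` on `S`,
and off `S` it is `Pr[i ∈ S' ∖ S] / Pr[i ∉ S] = (p_i - q) / (1 - q)`, where vertices are put in
`S'` with probability `p_i` and a vertex of `S'` is put in `S` with probability `q / p_i`. -/
def pStar (p : Fin n → ℝ) (q : ℝ) (S : Finset (Fin n)) (i : Fin n) : ℝ :=
  if i ∈ S then 1 else (p i - q) / (1 - q)

/-- The edge weights `w*_ij = 1 / (p*_i p*_j Δ²)`. -/
def wStar (G : SimpleGraph (Fin n)) [DecidableRel G.Adj] (ps : Fin n → ℝ) (i j : Fin n) : ℝ :=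
  1 / (ps i * ps j * avgDegree G ^ 2)

/-- `f(y) = ∑_i y_i |∑_{j ∈ Γ(i)} w*_ij c_j (y_j - p*_j)|`. -/
def quadDev (G : SimpleGraph (Fin n)) [DecidableRel G.Adj] (ps c y : Fin n → ℝ) : ℝ :=
  ∑ i, y i * |∑ j ∈ G.neighborFinset i, wStar G ps i j * c j * (y j - ps j)|

/-- `y` is good: `∑_{j ∈ Γ(i)} w*_ij y_j ≤ (ε Δ + 2 d_i) / (p*_i Δ²)` for every vertex `i`. -/
def IsGood (G : SimpleGraph (Fin n)) [DecidableRel G.Adj] (ε : ℝ) (ps y : Fin n → ℝ) : Prop :=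
  ∀ i, ∑ j ∈ G.neighborFinset i, wStar G ps i j * y j ≤
    (ε * avgDegree G + 2 * G.degree i) / (ps i * avgDegree G ^ 2)

end CoreSet

end

/-!
The random set `{i | Y i = 1}` is a product Bernoulli set, so all probabilities are finite sums
`bernExp` over subsets (`measureReal_eq_bernExp`), and moments are bounded by induction over the
coordinates. For a function with differences `L i`, `bernExp_sq_le` bounds the variance and
`bernExp_exp_le` the exponential moments by those of a sum of independent variables with variances
`p i * (1 - p i) * L i ^ 2`; deterministic coordinates contribute nothing.

The function `f` of the theorem, `quadDev`, has small differences only near good configurations.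
However, from a good `y` to an arbitrary `x` it drops by at most a weighted Hamming distance
(`quadDev_sub_le`). Hence `g x = max {f y - d x y | y good}` is Lipschitz on the whole cube, agrees
with `f` on good configurations, and stays below `f` everywhere (`exists_lipschitz_minorant`). So
the mean of `g` is at most that of `f`, which is at most half of the threshold by a second-moment
estimate (`bernExp_quadDev_le`), and the exponential moments of `g` bound the probability that `Y`
is good and `f Y` is large (`bernExp_quadDev_tail_le`).

The weights `1 / p*_j` that are not equal to one are at most `2 Δ α / ε` (`isSampling_pStar`), so an
exponential moment bound for each neighbourhood and a union bound show that `Y` is good with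
probability at least one half (`half_le_bernExp_isGood`). Conditioning thus costs only a factor
of two.
-/

namespace CoreSet

/-! ### Expectations over independent Bernoulli variables -/

section Bernoulli

variable {ι : Type*} [DecidableEq ι]

/-- The probability that a random subset of `I`, containing each `i ∈ I` independently with
probability `p i`, equals `s`. -/
noncomputable def bernWeight (p : ι → ℝ) (I s : Finset ι) : ℝ :=
  ∏ i ∈ I, if i ∈ s then p i else 1 - p i

/-- The expectation of `g` at a random subset of `I` that contains each `i ∈ I` independently
with probability `p i`. -/
noncomputable def bernExp (p : ι → ℝ) (I : Finset ι) (g : Finset ι → ℝ) : ℝ :=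
  ∑ s ∈ I.powerset, bernWeight p I s * g s

variable {p : ι → ℝ} {I : Finset ι}

lemma bernWeight_nonneg (hp0 : ∀ i, 0 ≤ p i) (hp1 : ∀ i, p i ≤ 1) (s : Finset ι) :
    0 ≤ bernWeight p I s := by
  refine Finset.prod_nonneg fun i _ => ?_
  split_ifs
  · exact hp0 i
  · linarith [hp1 i]

lemma bernExp_empty (g : Finset ι → ℝ) : bernExp p ∅ g = g ∅ := by
  simp [bernExp, bernWeight]

/-- Conditioning on one coordinate. -/
lemma bernExp_insert {a : ι} (ha : a ∉ I) (g : Finset ι → ℝ) :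
    bernExp p (insert a I) g = bernExp p I fun s => p a * g (insert a s) + (1 - p a) * g s := by
  unfold bernExp
  rw [Finset.sum_powerset_insert ha, ← Finset.sum_add_distrib]
  refine Finset.sum_congr rfl fun s hs => ?_
  have has : a ∉ s := fun h => ha (Finset.mem_powerset.1 hs h)
  have h1 : bernWeight p (insert a I) s = (1 - p a) * bernWeight p I s := by
    simp [bernWeight, Finset.prod_insert ha, has]
  have h2 : bernWeight p (insert a I) (insert a s) = p a * bernWeight p I s := by
    unfold bernWeight
    rw [Finset.prod_insert ha, if_pos (Finset.mem_insert_self a s)]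
    congr 1
    refine Finset.prod_congr rfl fun i hi => ?_
    have : i ≠ a := fun h => ha (h ▸ hi)
    simp [this]
  rw [h1, h2]
  ring

lemma bernExp_mono (hp0 : ∀ i, 0 ≤ p i) (hp1 : ∀ i, p i ≤ 1) {g g' : Finset ι → ℝ}
    (h : ∀ s, g s ≤ g' s) : bernExp p I g ≤ bernExp p I g' :=
  Finset.sum_le_sum fun s _ => mul_le_mul_of_nonneg_left (h s) (bernWeight_nonneg hp0 hp1 s)

lemma bernExp_add (g g' : Finset ι → ℝ) :
    bernExp p I (fun s => g s + g' s) = bernExp p I g + bernExp p I g' := by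
  simp [bernExp, mul_add, Finset.sum_add_distrib]

lemma bernExp_const_mul (k : ℝ) (g : Finset ι → ℝ) :
    bernExp p I (fun s => k * g s) = k * bernExp p I g := by
  simp only [bernExp, Finset.mul_sum]
  exact Finset.sum_congr rfl fun s _ => by ring

lemma bernExp_sum {κ : Type*} (J : Finset κ) (g : κ → Finset ι → ℝ) :
    bernExp p I (fun s => ∑ j ∈ J, g j s) = ∑ j ∈ J, bernExp p I (g j) := by
  simp only [bernExp, Finset.mul_sum]
  exact Finset.sum_comm

lemma bernExp_const (k : ℝ) : bernExp p I (fun _ => k) = k := by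
  induction I using Finset.induction_on with
  | empty => exact bernExp_empty _
  | insert a I ha ih =>
    rw [bernExp_insert ha]
    convert ih using 2
    ext s
    ring

/-- The average over one coordinate inherits the bounded differences in the others. -/
lemma abs_average_insert_sub_le (hp0 : ∀ i, 0 ≤ p i) (hp1 : ∀ i, p i ≤ 1)
    {a i : ι} (hia : i ≠ a) {g : Finset ι → ℝ} {L : ℝ}
    (hg : ∀ s, i ∉ s → |g (insert i s) - g s| ≤ L) (s : Finset ι) (his : i ∉ s) :
    |(p a * g (insert a (insert i s)) + (1 - p a) * g (insert i s)) -
      (p a * g (insert a s) + (1 - p a) * g s)| ≤ L := by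
  have h1 := abs_le.1 (hg s his)
  have h2 := abs_le.1 (hg (insert a s) (by simp [hia, his]))
  rw [Finset.insert_comm] at h2
  have h3 := hp0 a
  have h4 := sub_nonneg.2 (hp1 a)
  rw [abs_le]
  constructor <;> nlinarith [mul_le_mul_of_nonneg_left h1.1 h4, mul_le_mul_of_nonneg_left h1.2 h4,
    mul_le_mul_of_nonneg_left h2.1 h3, mul_le_mul_of_nonneg_left h2.2 h3]

/-- The Efron–Stein inequality for a function with bounded differences. -/
lemma bernExp_sq_le (hp0 : ∀ i, 0 ≤ p i) (hp1 : ∀ i, p i ≤ 1) (L : ι → ℝ)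
    (g : Finset ι → ℝ) (hg : ∀ i ∈ I, ∀ s, i ∉ s → |g (insert i s) - g s| ≤ L i) :
    bernExp p I (fun s => g s ^ 2) ≤
      bernExp p I g ^ 2 + ∑ i ∈ I, p i * (1 - p i) * L i ^ 2 := by
  induction I using Finset.induction_on generalizing g with
  | empty => simp [bernExp_empty]
  | insert a I ha ih =>
    rw [bernExp_insert ha, bernExp_insert ha, Finset.sum_insert ha]
    have ih' := ih (fun s => p a * g (insert a s) + (1 - p a) * g s) fun i hi s his =>
      abs_average_insert_sub_le hp0 hp1 (ne_of_mem_of_not_mem hi ha)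
        (hg i (Finset.mem_insert_of_mem hi)) s his
    -- in one coordinate, the second moment is the squared mean plus the variance
    have key : bernExp p I (fun s => p a * g (insert a s) ^ 2 + (1 - p a) * g s ^ 2) ≤
        bernExp p I (fun s => (p a * g (insert a s) + (1 - p a) * g s) ^ 2 +
          p a * (1 - p a) * L a ^ 2) := by
      refine Finset.sum_le_sum fun s hs =>
        mul_le_mul_of_nonneg_left ?_ (bernWeight_nonneg hp0 hp1 s)
      have has : a ∉ s := fun h => ha (Finset.mem_powerset.1 hs h)
      have h1 := sq_le_sq' (abs_le.1 (hg a (Finset.mem_insert_self a I) s has)).1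
        (abs_le.1 (hg a (Finset.mem_insert_self a I) s has)).2
      nlinarith [mul_le_mul_of_nonneg_left h1 (mul_nonneg (hp0 a) (sub_nonneg.2 (hp1 a)))]
    rw [bernExp_add (fun s => (p a * g (insert a s) + (1 - p a) * g s) ^ 2), bernExp_const] at key
    linarith

/-- The two-point case of the moment bound `bernExp_exp_le`. -/
lemma bernoulli_exp_le {q x y L : ℝ} (hq0 : 0 ≤ q) (hq1 : q ≤ 1) (hxy : |x - y| ≤ L)
    (h : q = 1 ∨ L ≤ 1) :
    q * Real.exp x + (1 - q) * Real.exp y ≤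
      Real.exp (q * x + (1 - q) * y + q * (1 - q) * L ^ 2) := by
  rcases h with rfl | hL
  · simp
  have hL' := abs_le.1 hxy
  have hq1' := sub_nonneg.2 hq1
  have hb : ∀ z : ℝ, |z| ≤ 1 → Real.exp z ≤ 1 + z + z ^ 2 := fun z hz => by
    have := abs_le.1 (Real.abs_exp_sub_one_sub_id_le hz)
    linarith [this.2]
  have habs : |x - y| ≤ 1 := hxy.trans hL
  -- the deviations of the two values from the mean
  have hx := hb ((1 - q) * (x - y)) (by
    rw [abs_mul, abs_of_nonneg hq1']
    exact mul_le_one₀ (by linarith) (abs_nonneg _) habs)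
  have hy := hb (-(q * (x - y))) (by
    rw [abs_neg, abs_mul, abs_of_nonneg hq0]
    exact mul_le_one₀ hq1 (abs_nonneg _) habs)
  have hsq : (x - y) ^ 2 ≤ L ^ 2 := sq_le_sq' hL'.1 hL'.2
  have h1 : Real.exp x = Real.exp (q * x + (1 - q) * y) * Real.exp ((1 - q) * (x - y)) := by
    rw [← Real.exp_add]; ring_nf
  have h2 : Real.exp y = Real.exp (q * x + (1 - q) * y) * Real.exp (-(q * (x - y))) := by
    rw [← Real.exp_add]; ring_nf
  rw [Real.exp_add, h1, h2]
  have hE := Real.exp_pos (q * x + (1 - q) * y)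
  have h3 := Real.add_one_le_exp (q * (1 - q) * L ^ 2)
  have h4 : q * Real.exp ((1 - q) * (x - y)) + (1 - q) * Real.exp (-(q * (x - y))) ≤
      Real.exp (q * (1 - q) * L ^ 2) := by
    nlinarith [mul_le_mul_of_nonneg_left hx hq0, mul_le_mul_of_nonneg_left hy hq1',
      mul_le_mul_of_nonneg_left hsq (mul_nonneg hq0 hq1')]
  nlinarith [mul_le_mul_of_nonneg_left h4 hE.le]

/-- A Bernstein-type moment bound: a function with differences at most `L i` has the exponential
moments of a sum of independent variables of variance `p i * (1 - p i) * L i ^ 2`, as long as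
`l * L i ≤ 1` at every coordinate that is not deterministic. -/
lemma bernExp_exp_le (hp0 : ∀ i, 0 ≤ p i) (hp1 : ∀ i, p i ≤ 1) (L : ι → ℝ) {l : ℝ} (hl : 0 ≤ l)
    (hL : ∀ i ∈ I, p i = 1 ∨ l * L i ≤ 1)
    (g : Finset ι → ℝ) (hg : ∀ i ∈ I, ∀ s, i ∉ s → |g (insert i s) - g s| ≤ L i) :
    bernExp p I (fun s => Real.exp (l * g s)) ≤
      Real.exp (l * bernExp p I g + l ^ 2 * ∑ i ∈ I, p i * (1 - p i) * L i ^ 2) := by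
  induction I using Finset.induction_on generalizing g with
  | empty => simp [bernExp_empty]
  | insert a I ha ih =>
    rw [bernExp_insert ha, bernExp_insert ha, Finset.sum_insert ha]
    have ih' := ih (fun i hi => hL i (Finset.mem_insert_of_mem hi))
      (fun s => p a * g (insert a s) + (1 - p a) * g s) fun i hi s his =>
        abs_average_insert_sub_le hp0 hp1 (ne_of_mem_of_not_mem hi ha)
          (hg i (Finset.mem_insert_of_mem hi)) s his
    have key : bernExp p I
          (fun s => p a * Real.exp (l * g (insert a s)) + (1 - p a) * Real.exp (l * g s)) ≤
        bernExp p I (fun s => Real.exp (p a * (1 - p a) * (l * L a) ^ 2) *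
          Real.exp (l * (p a * g (insert a s) + (1 - p a) * g s))) := by
      refine Finset.sum_le_sum fun s hs =>
        mul_le_mul_of_nonneg_left ?_ (bernWeight_nonneg hp0 hp1 s)
      have has : a ∉ s := fun h => ha (Finset.mem_powerset.1 hs h)
      have hd : |l * g (insert a s) - l * g s| ≤ l * L a := by
        rw [← mul_sub, abs_mul, abs_of_nonneg hl]
        exact mul_le_mul_of_nonneg_left (hg a (Finset.mem_insert_self a I) s has) hl
      refine (bernoulli_exp_le (hp0 a) (hp1 a) hd (hL a (Finset.mem_insert_self a I))).trans ?_
      beta_reduce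
      rw [← Real.exp_add]
      exact Real.exp_le_exp.2 (le_of_eq (by ring))
    rw [bernExp_const_mul] at key
    refine key.trans ((mul_le_mul_of_nonneg_left ih' (Real.exp_pos _).le).trans ?_)
    rw [← Real.exp_add]
    exact Real.exp_le_exp.2 (by nlinarith)

/-- Factoring out the indicator of one coordinate. -/
lemma bernExp_ite_mem_mul {a : ι} (ha : a ∈ I) {g : Finset ι → ℝ}
    (hg : ∀ s, g (insert a s) = g s) :
    bernExp p I (fun s => (if a ∈ s then 1 else 0) * g s) =
      p a * bernExp p (I.erase a) g := by
  conv_lhs => rw [← Finset.insert_erase ha]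
  rw [bernExp_insert (Finset.notMem_erase a I), ← bernExp_const_mul]
  refine Finset.sum_congr rfl fun s hs => ?_
  have has : a ∉ s := fun h => Finset.notMem_erase a I (Finset.mem_powerset.1 hs h)
  simp [has, hg]

lemma bernExp_ite_mem {a : ι} (ha : a ∈ I) :
    bernExp p I (fun s => if a ∈ s then 1 else 0) = p a := by
  have := bernExp_ite_mem_mul (p := p) ha (g := fun _ => 1) fun _ => rfl
  simpa [bernExp_const] using this

end Bernoulli

/-- Extension of a Lipschitz function `f` from `A`, which stays below `f` because `f` drops by at
most `d` on the way from `A` to any point. -/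
lemma exists_lipschitz_minorant {α : Type*} (A : Finset α) (hA : A.Nonempty) (f : α → ℝ)
    (d : α → α → ℝ) (hd0 : ∀ x, d x x = 0) (hd : ∀ x y z, d x z ≤ d x y + d y z)
    (hf : ∀ y ∈ A, ∀ x, f y - f x ≤ d x y) :
    ∃ g : α → ℝ, (∀ x, g x ≤ f x) ∧ (∀ x ∈ A, g x = f x) ∧ ∀ x y, g x - g y ≤ d y x := by
  have hle : ∀ x, A.sup' hA (fun y => f y - d x y) ≤ f x := fun x =>
    Finset.sup'_le _ _ fun y hy => by linarith [hf y hy x]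
  refine ⟨fun x => A.sup' hA fun y => f y - d x y, hle, fun x hx => ?_, fun x y => ?_⟩
  · refine le_antisymm (hle x) ?_
    have := Finset.le_sup' (fun y => f y - d x y) hx
    simp only [hd0, sub_zero] at this
    exact this
  · rw [sub_le_iff_le_add]
    refine Finset.sup'_le _ _ fun z hz => ?_
    have := Finset.le_sup' (fun z => f z - d y z) hz
    beta_reduce at this
    linarith [hd y x z]

variable {n : ℕ}

/-! ### Deterministic bounds for the quadratic deviation -/

/-- The bound on the weighted number of sampled neighbours of `i` in the definition of a good
configuration. -/
noncomputable def goodBound (G : SimpleGraph (Fin n)) [DecidableRel G.Adj] (ε : ℝ)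
    (ps : Fin n → ℝ) (i : Fin n) : ℝ :=
  (ε * avgDegree G + 2 * G.degree i) / (ps i * avgDegree G ^ 2)

section Deterministic

variable {G : SimpleGraph (Fin n)} [DecidableRel G.Adj] {ε : ℝ} {ps c : Fin n → ℝ}

lemma wStar_comm (i j : Fin n) : wStar G ps i j = wStar G ps j i := by
  unfold wStar
  rw [mul_comm (ps i)]

lemma wStar_nonneg (hp : ∀ i, 0 < ps i) (i j : Fin n) : 0 ≤ wStar G ps i j := by
  have := hp i
  have := hp j
  unfold wStar
  positivity

lemma goodBound_nonneg (hε : 0 ≤ ε) (hD : 0 ≤ avgDegree G) (hp : ∀ i, 0 < ps i) (i : Fin n) :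
    0 ≤ goodBound G ε ps i := by
  have := hp i
  unfold goodBound
  positivity

lemma sum_wStar_mul_le (hε : 0 ≤ ε) (hD : 0 < avgDegree G) (hp : ∀ i, 0 < ps i) (i : Fin n) :
    ∑ j ∈ G.neighborFinset i, wStar G ps i j * ps j ≤ goodBound G ε ps i := by
  have hi := hp i
  have h : ∀ j, wStar G ps i j * ps j = 1 / (ps i * avgDegree G ^ 2) := fun j => by
    have := (hp j).ne'
    unfold wStar
    field_simp
  simp only [h, Finset.sum_const, G.card_neighborFinset_eq_degree, nsmul_eq_mul, goodBound]
  rw [mul_one_div]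
  refine div_le_div_of_nonneg_right ?_ (by positivity)
  have : 0 ≤ ε * avgDegree G := by positivity
  have : (0 : ℝ) ≤ G.degree i := by positivity
  linarith

lemma abs_dev_le (hε : 0 ≤ ε) (hD : 0 < avgDegree G) (hp : ∀ i, 0 < ps i)
    (hc : ∀ j, 0 ≤ c j ∧ c j ≤ 2) {y : Fin n → ℝ} (hy : ∀ i, 0 ≤ y i)
    (hgood : IsGood G ε ps y) (i : Fin n) :
    |∑ j ∈ G.neighborFinset i, wStar G ps i j * c j * (y j - ps j)| ≤
      2 * goodBound G ε ps i := by
  have h1 : ∑ j ∈ G.neighborFinset i, wStar G ps i j * c j * y j ≤ 2 * goodBound G ε ps i := by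
    refine le_trans ?_ (mul_le_mul_of_nonneg_left (hgood i) zero_le_two)
    rw [Finset.mul_sum]
    refine Finset.sum_le_sum fun j _ => ?_
    nlinarith [mul_le_mul_of_nonneg_left (hc j).2 (mul_nonneg (wStar_nonneg (G := G) hp i j) (hy j))]
  have h2 : ∑ j ∈ G.neighborFinset i, wStar G ps i j * c j * ps j ≤
      2 * goodBound G ε ps i := by
    refine le_trans ?_ (mul_le_mul_of_nonneg_left (sum_wStar_mul_le hε hD hp i) zero_le_two)
    rw [Finset.mul_sum]
    refine Finset.sum_le_sum fun j _ => ?_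
    nlinarith [mul_le_mul_of_nonneg_left (hc j).2
      (mul_nonneg (wStar_nonneg (G := G) hp i j) (hp j).le)]
  have h3 : 0 ≤ ∑ j ∈ G.neighborFinset i, wStar G ps i j * c j * y j :=
    Finset.sum_nonneg fun j _ => mul_nonneg (mul_nonneg (wStar_nonneg hp i j) (hc j).1) (hy j)
  have h4 : 0 ≤ ∑ j ∈ G.neighborFinset i, wStar G ps i j * c j * ps j :=
    Finset.sum_nonneg fun j _ =>
      mul_nonneg (mul_nonneg (wStar_nonneg hp i j) (hc j).1) (hp j).le
  simp only [mul_sub, Finset.sum_sub_distrib]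
  rw [abs_le]
  constructor <;> linarith

/-- From a good `y` to an arbitrary `x`, the quadratic deviation drops by at most a weighted
Hamming distance. Only `y` has to be good: the terms of `x` outside `y` are nonnegative and can be
dropped, and all others are controlled by the neighbourhoods in `y`. -/
lemma quadDev_sub_le (hε : 0 ≤ ε) (hD : 0 < avgDegree G) (hp : ∀ i, 0 < ps i)
    (hc : ∀ j, 0 ≤ c j ∧ c j ≤ 2) {x y : Fin n → ℝ} (hx : ∀ i, 0 ≤ x i) (hy : ∀ i, 0 ≤ y i)
    (hgood : IsGood G ε ps y) :
    quadDev G ps c y - quadDev G ps c x ≤ ∑ j, 4 * goodBound G ε ps j * |x j - y j| := by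
  set D : (Fin n → ℝ) → Fin n → ℝ :=
    fun z i => ∑ j ∈ G.neighborFinset i, wStar G ps i j * c j * (z j - ps j) with hDdef
  have hterm : ∀ i, y i * |D y i| - x i * |D x i| ≤
      2 * goodBound G ε ps i * |x i - y i| +
        y i * ∑ j ∈ G.neighborFinset i, wStar G ps i j * c j * |x j - y j| := by
    intro i
    have hdiff : |D y i| - |D x i| ≤
        ∑ j ∈ G.neighborFinset i, wStar G ps i j * c j * |x j - y j| := by
      refine (abs_sub_abs_le_abs_sub _ _).trans ?_
      have : D y i - D x i = ∑ j ∈ G.neighborFinset i, wStar G ps i j * c j * (y j - x j) := by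
        simp only [hDdef, ← Finset.sum_sub_distrib]
        exact Finset.sum_congr rfl fun j _ => by ring
      rw [this]
      refine (Finset.abs_sum_le_sum_abs _ _).trans (le_of_eq ?_)
      refine Finset.sum_congr rfl fun j _ => ?_
      rw [abs_mul, abs_of_nonneg (mul_nonneg (wStar_nonneg hp i j) (hc j).1), abs_sub_comm]
    have hDy := abs_dev_le hε hD hp hc hy hgood i
    have hb := goodBound_nonneg hε hD.le hp i
    have hS : 0 ≤ ∑ j ∈ G.neighborFinset i, wStar G ps i j * c j * |x j - y j| :=
      Finset.sum_nonneg fun j _ =>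
        mul_nonneg (mul_nonneg (wStar_nonneg hp i j) (hc j).1) (abs_nonneg _)
    have h0 := abs_nonneg (D x i)
    change |D y i| ≤ _ at hDy
    rcases le_total (y i) (x i) with h | h
    · rw [abs_of_nonneg (sub_nonneg.2 h)]
      nlinarith [mul_le_mul_of_nonneg_left hdiff (hy i), mul_le_mul_of_nonneg_right h h0,
        mul_nonneg hb (sub_nonneg.2 h)]
    · rw [abs_of_nonpos (sub_nonpos.2 h)]
      nlinarith [mul_le_mul_of_nonneg_left hdiff (hx i),
        mul_le_mul_of_nonneg_left hDy (sub_nonneg.2 h), mul_le_mul_of_nonneg_right h hS]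
  have hswap : ∑ i, y i * ∑ j ∈ G.neighborFinset i, wStar G ps i j * c j * |x j - y j| ≤
      ∑ j, 2 * goodBound G ε ps j * |x j - y j| := by
    have : ∑ i, y i * ∑ j ∈ G.neighborFinset i, wStar G ps i j * c j * |x j - y j| =
        ∑ j, c j * |x j - y j| * ∑ i ∈ G.neighborFinset j, wStar G ps j i * y i := by
      simp only [Finset.mul_sum]
      rw [Finset.sum_comm' (t' := Finset.univ) (s' := fun j => G.neighborFinset j)]
      · refine Finset.sum_congr rfl fun j _ => Finset.sum_congr rfl fun i _ => ?_
        rw [wStar_comm i j]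
        ring
      · intro i j
        simp [G.adj_comm]
    rw [this]
    refine Finset.sum_le_sum fun j _ => ?_
    have h1 := mul_le_mul_of_nonneg_left (hgood j) (mul_nonneg (hc j).1 (abs_nonneg (x j - y j)))
    have h2 := mul_le_mul_of_nonneg_right (hc j).2
      (mul_nonneg (goodBound_nonneg hε hD.le hp j) (abs_nonneg (x j - y j)))
    unfold goodBound at h2 ⊢
    linarith
  have hsum := Finset.sum_le_sum fun i (_ : i ∈ Finset.univ) => hterm i
  rw [Finset.sum_sub_distrib, Finset.sum_add_distrib] at hsum
  change quadDev G ps c y - quadDev G ps c x ≤ _ at hsum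
  refine hsum.trans ((add_le_add_right hswap _).trans (le_of_eq ?_))
  rw [← Finset.sum_add_distrib]
  exact Finset.sum_congr rfl fun j _ => by ring

end Deterministic

/-! ### The mean, the variance proxy and the good event -/

/-- The indicator vector of a set of vertices. -/
noncomputable def ind (s : Finset (Fin n)) (i : Fin n) : ℝ := if i ∈ s then 1 else 0

lemma ind_nonneg (s : Finset (Fin n)) (i : Fin n) : 0 ≤ ind s i := by
  unfold ind
  split_ifs <;> norm_num

lemma ind_insert_of_ne {i j : Fin n} (h : j ≠ i) (s : Finset (Fin n)) :
    ind (insert i s) j = ind s j := by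
  simp [ind, h]

lemma sum_mul_ind_insert_sub {J s : Finset (Fin n)} {i : Fin n} (his : i ∉ s)
    (a : Fin n → ℝ) :
    ∑ j ∈ J, a j * ind (insert i s) j - ∑ j ∈ J, a j * ind s j = if i ∈ J then a i else 0 := by
  rw [← Finset.sum_sub_distrib, ← Finset.sum_ite_eq' J i a]
  refine Finset.sum_congr rfl fun j _ => ?_
  by_cases h : j = i
  · subst h
    simp [ind, his]
  · simp [ind_insert_of_ne h, h]

lemma bernExp_sum_mul_ind {ps : Fin n → ℝ} {I J : Finset (Fin n)} (hJ : J ⊆ I) (a : Fin n → ℝ) :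
    bernExp ps I (fun s => ∑ j ∈ J, a j * ind s j) = ∑ j ∈ J, a j * ps j := by
  rw [bernExp_sum]
  refine Finset.sum_congr rfl fun j hj => ?_
  rw [bernExp_const_mul]
  exact congrArg _ (bernExp_ite_mem (hJ hj))

section Random

variable {G : SimpleGraph (Fin n)} [DecidableRel G.Adj] {ε β : ℝ} {ps c : Fin n → ℝ}

lemma sum_degree_eq (hD : 0 < avgDegree G) : ∑ i, (G.degree i : ℝ) = n * avgDegree G := by
  have hn : (n : ℝ) ≠ 0 := fun h => by simp [avgDegree, h] at hD
  unfold avgDegree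
  field_simp

/-- A vertex which is not sampled with certainty has a sampling probability of the order of its
importance score. -/
def IsSampling (G : SimpleGraph (Fin n)) [DecidableRel G.Adj] (ε β : ℝ) (ps : Fin n → ℝ) : Prop :=
  ∀ i, 0 < ps i ∧ ps i ≤ 1 ∧
    (ps i = 1 ∨ max (G.degree i : ℝ) (ε * avgDegree G) ≤ 2 * avgDegree G ^ 2 * β * ps i)

lemma IsSampling.le_of_ne_one (h : IsSampling G ε β ps) (hD : 0 < avgDegree G) {i : Fin n}
    (hi : ps i ≠ 1) : ε ≤ 2 * avgDegree G * β * ps i := by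
  have := (le_max_right _ _).trans ((h i).2.2.resolve_left hi)
  nlinarith

/-- The mean of the quadratic deviation, by the second moments of the inner sums. -/
lemma bernExp_quadDev_le (hε : 0 < ε) (hD : 0 < avgDegree G) (hβ : 0 < β)
    (hβε : 2048 * β ≤ ε ^ 3) (hp : IsSampling G ε β ps) (hc : ∀ j, 0 ≤ c j ∧ c j ≤ 2) :
    bernExp ps Finset.univ (fun s => quadDev G ps c (ind s)) ≤
      ε * n / (16 * avgDegree G) := by
  set D := avgDegree G with hDdef
  have hp0 : ∀ i, 0 ≤ ps i := fun i => (hp i).1.le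
  have hp1 : ∀ i, ps i ≤ 1 := fun i => (hp i).2.1
  set F : Fin n → Finset (Fin n) → ℝ := fun i s =>
    ∑ j ∈ G.neighborFinset i, wStar G ps i j * c j * (ind s j - ps j) with hF
  have hFeq : ∀ i s, F i s = ∑ j ∈ G.neighborFinset i, wStar G ps i j * c j * ind s j +
      (-∑ j ∈ G.neighborFinset i, wStar G ps i j * c j * ps j) := fun i s => by
    simp only [hF, mul_sub, Finset.sum_sub_distrib]
    ring
  have hsub : ∀ i, G.neighborFinset i ⊆ Finset.univ.erase i := fun i j hj => by
    simp only [SimpleGraph.mem_neighborFinset] at hj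
    simp [hj.ne']
  have hmean : ∀ i, bernExp ps (Finset.univ.erase i) (F i) = 0 := fun i => by
    have : F i = fun s => ∑ j ∈ G.neighborFinset i, wStar G ps i j * c j * ind s j +
      (-∑ j ∈ G.neighborFinset i, wStar G ps i j * c j * ps j) := funext (hFeq i)
    rw [this, bernExp_add, bernExp_sum_mul_ind (hsub i), bernExp_const, add_neg_cancel]
  have hsq : ∀ i, bernExp ps (Finset.univ.erase i) (fun s => F i s ^ 2) ≤
      G.degree i * (8 * β / (ps i ^ 2 * D ^ 3 * ε)) := by
    intro i
    have hi := (hp i).1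
    have h := bernExp_sq_le (I := Finset.univ.erase i) hp0 hp1
      (fun j => if j ∈ G.neighborFinset i then wStar G ps i j * c j else 0) (F i) (by
        intro j _ s hjs
        rw [hFeq, hFeq, add_sub_add_right_eq_sub, sum_mul_ind_insert_sub hjs]
        split_ifs
        · exact (abs_of_nonneg (mul_nonneg (wStar_nonneg (fun i => (hp i).1) i j) (hc j).1)).le
        · simp)
    rw [hmean, zero_pow two_ne_zero, zero_add] at h
    refine h.trans ?_
    have h2 : ∑ j ∈ Finset.univ.erase i, ps j * (1 - ps j) *
        (if j ∈ G.neighborFinset i then wStar G ps i j * c j else 0) ^ 2 =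
        ∑ j ∈ G.neighborFinset i, ps j * (1 - ps j) * (wStar G ps i j * c j) ^ 2 := by
      rw [← Finset.sum_subset (hsub i)]
      · exact Finset.sum_congr rfl fun j hj => by rw [if_pos hj]
      · intro j _ hj
        rw [if_neg hj]
        ring
    rw [h2, ← G.card_neighborFinset_eq_degree, ← nsmul_eq_mul]
    refine Finset.sum_le_card_nsmul _ _ _ fun j _ => ?_
    by_cases hj1 : ps j = 1
    · rw [hj1, sub_self, mul_zero, zero_mul]
      positivity
    have hj := (hp j).1
    have hjm := hp.le_of_ne_one hD hj1
    have hcj : c j ^ 2 ≤ 4 := by nlinarith [(hc j).1, (hc j).2]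
    have e : ps j * (1 - ps j) * (wStar G ps i j * c j) ^ 2 =
        (1 - ps j) * c j ^ 2 / (ps i ^ 2 * ps j * D ^ 4) := by
      unfold wStar
      rw [← hDdef]
      field_simp
    rw [e, div_le_div_iff₀ (by positivity) (by positivity)]
    have h3 : (1 - ps j) * c j ^ 2 ≤ 4 := by nlinarith [sq_nonneg (c j)]
    calc (1 - ps j) * c j ^ 2 * (ps i ^ 2 * D ^ 3 * ε)
        ≤ 4 * (ps i ^ 2 * D ^ 3 * (2 * D * β * ps j)) := by gcongr
      _ = 8 * β * (ps i ^ 2 * ps j * D ^ 4) := by ring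
  have hterm : ∀ i, bernExp ps Finset.univ (fun s => ind s i * |F i s|) ≤
      64 * β * G.degree i / (D ^ 2 * ε ^ 2) + ε / (32 * D) := by
    intro i
    have hi := (hp i).1
    have h1 := bernExp_ite_mem_mul (p := ps) (Finset.mem_univ i) (g := fun s => |F i s|)
      (fun s => by
        refine congrArg abs (Finset.sum_congr rfl fun j hj => ?_)
        rw [ind_insert_of_ne (Finset.ne_of_mem_erase (hsub i hj))])
    -- `|F| ≤ (8 D p / ε) F ^ 2 + ε / (32 D p)`, with the weight balancing the two terms
    have h2 : bernExp ps (Finset.univ.erase i) (fun s => |F i s|) ≤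
        bernExp ps (Finset.univ.erase i)
          (fun s => 8 * D * ps i / ε * F i s ^ 2 + ε / (32 * D * ps i)) := by
      refine bernExp_mono hp0 hp1 fun s => ?_
      rw [← sq_abs (F i s)]
      set z := |F i s|
      have : 8 * D * ps i / ε * z ^ 2 + ε / (32 * D * ps i) - z =
          (16 * D * ps i * z - ε) ^ 2 / (32 * D * ps i * ε) := by
        field_simp
        ring
      have h0 : 0 ≤ (16 * D * ps i * z - ε) ^ 2 / (32 * D * ps i * ε) := by positivity
      linarith
    rw [bernExp_add, bernExp_const_mul, bernExp_const] at h2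
    change bernExp ps Finset.univ (fun s => (if i ∈ s then 1 else 0) * |F i s|) ≤ _
    rw [h1]
    calc ps i * bernExp ps (Finset.univ.erase i) (fun s => |F i s|)
        ≤ ps i * (8 * D * ps i / ε * (G.degree i * (8 * β / (ps i ^ 2 * D ^ 3 * ε))) +
            ε / (32 * D * ps i)) := by
          refine mul_le_mul_of_nonneg_left (h2.trans ?_) hi.le
          gcongr
          exact hsq i
      _ = 64 * β * G.degree i / (D ^ 2 * ε ^ 2) + ε / (32 * D) := by
          field_simp
          ring
  have hq : bernExp ps Finset.univ (fun s => quadDev G ps c (ind s)) =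
      ∑ i, bernExp ps Finset.univ (fun s => ind s i * |F i s|) := by
    rw [← bernExp_sum]
    rfl
  rw [hq]
  refine (Finset.sum_le_sum fun i _ => hterm i).trans ?_
  rw [Finset.sum_add_distrib, ← Finset.sum_div, ← Finset.mul_sum, sum_degree_eq hD, ← hDdef]
  simp only [Finset.sum_const, Finset.card_univ, Fintype.card_fin, nsmul_eq_mul]
  have e1 : 64 * β * (n * D) / (D ^ 2 * ε ^ 2) = 2048 * β * (n / (32 * D * ε ^ 2)) := by
    field_simp
    ring
  rw [e1]
  calc 2048 * β * (n / (32 * D * ε ^ 2)) + n * (ε / (32 * D))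
      ≤ ε ^ 3 * (n / (32 * D * ε ^ 2)) + n * (ε / (32 * D)) := by gcongr
    _ = ε * n / (16 * D) := by
        field_simp
        ring

lemma goodBound_mul_le (hD : 0 < avgDegree G) (hp : IsSampling G ε β ps)
    (i : Fin n) :
    4 * goodBound G ε ps i * ps i ≤
      12 * max (G.degree i : ℝ) (ε * avgDegree G) / avgDegree G ^ 2 := by
  have hi := (hp i).1
  have e : 4 * goodBound G ε ps i * ps i =
      4 * (ε * avgDegree G + 2 * G.degree i) / avgDegree G ^ 2 := by
    unfold goodBound
    field_simp
  rw [e]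
  refine div_le_div_of_nonneg_right ?_ (by positivity)
  linarith [le_max_left (G.degree i : ℝ) (ε * avgDegree G),
    le_max_right (G.degree i : ℝ) (ε * avgDegree G)]

lemma goodBound_le (hD : 0 < avgDegree G) (hp : IsSampling G ε β ps)
    {i : Fin n} (hi : ps i ≠ 1) : 4 * goodBound G ε ps i ≤ 24 * β := by
  have h := goodBound_mul_le hD hp i
  have h2 := (hp i).2.2.resolve_left hi
  have h3 : 12 * max (G.degree i : ℝ) (ε * avgDegree G) / avgDegree G ^ 2 ≤ 24 * β * ps i := by
    rw [div_le_iff₀ (by positivity)]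
    linarith
  exact le_of_mul_le_mul_right (h.trans h3) (hp i).1

/-- The variance proxy of the Lipschitz extension of the quadratic deviation. -/
lemma sum_variance_le (hε : 0 ≤ ε) (hε1 : ε ≤ 1) (hD : 0 < avgDegree G) (hβ : 0 < β)
    (hp : IsSampling G ε β ps) :
    ∑ i, ps i * (1 - ps i) * (4 * goodBound G ε ps i) ^ 2 ≤ 576 * β * n / avgDegree G := by
  have hterm : ∀ i, ps i * (1 - ps i) * (4 * goodBound G ε ps i) ^ 2 ≤
      288 * β / avgDegree G ^ 2 * (G.degree i + ε * avgDegree G) := by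
    intro i
    have hi := (hp i).1
    by_cases h1 : ps i = 1
    · rw [h1, sub_self, mul_zero, zero_mul]
      positivity
    have hb := goodBound_nonneg hε hD.le (fun i => (hp i).1) i
    calc ps i * (1 - ps i) * (4 * goodBound G ε ps i) ^ 2
        ≤ ps i * 1 * (4 * goodBound G ε ps i) ^ 2 := by gcongr; linarith
      _ = 4 * goodBound G ε ps i * (4 * goodBound G ε ps i * ps i) := by ring
      _ ≤ 24 * β * (12 * max (G.degree i : ℝ) (ε * avgDegree G) / avgDegree G ^ 2) := by
          exact mul_le_mul (goodBound_le hD hp h1) (goodBound_mul_le hD hp i)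
            (by positivity) (by positivity)
      _ = 288 * β / avgDegree G ^ 2 * max (G.degree i : ℝ) (ε * avgDegree G) := by ring
      _ ≤ _ := by
          gcongr
          exact max_le (by have : 0 ≤ ε * avgDegree G := by positivity
                           linarith)
            (by have : (0 : ℝ) ≤ G.degree i := by positivity
                linarith)
  refine (Finset.sum_le_sum fun i _ => hterm i).trans ?_
  rw [← Finset.mul_sum, Finset.sum_add_distrib, sum_degree_eq hD]
  simp only [Finset.sum_const, Finset.card_univ, Fintype.card_fin, nsmul_eq_mul]
  calc 288 * β / avgDegree G ^ 2 * (n * avgDegree G + n * (ε * avgDegree G))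
      ≤ 288 * β / avgDegree G ^ 2 * (n * avgDegree G + n * (1 * avgDegree G)) := by gcongr
    _ = 576 * β * n / avgDegree G := by
        field_simp
        ring

/-- The sampled weight at one vertex exceeds its bound with exponentially small probability. -/
lemma bernExp_not_good_at_le (hε : 0 < ε) (hD : 0 < avgDegree G) (hβ : 0 < β)
    (hp : IsSampling G ε β ps) (i : Fin n) :
    bernExp ps Finset.univ (fun s => if ∑ j ∈ G.neighborFinset i, wStar G ps i j * ind s j ≤
      goodBound G ε ps i then 0 else 1) ≤ Real.exp (-(ε ^ 2 / (2 * β))) := by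
  set D := avgDegree G with hDdef
  have hp0 : ∀ i, 0 ≤ ps i := fun i => (hp i).1.le
  have hp1 : ∀ i, ps i ≤ 1 := fun i => (hp i).2.1
  have hi := (hp i).1
  -- `l` is a lower bound for the probabilities different from one
  set l := ε / (2 * D * β) with hl
  have hl0 : 0 < l := by positivity
  have hlp : ∀ j, ps j ≠ 1 → l * (1 / ps j) ≤ 1 := fun j hj => by
    have h1 := hp.le_of_ne_one hD hj
    have h2 := (hp j).1
    rw [mul_one_div, div_le_one h2, hl, div_le_iff₀ (by positivity)]
    linarith
  set L : Fin n → ℝ := fun j => if j ∈ G.neighborFinset i then 1 / ps j else 0 with hL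
  set g : Finset (Fin n) → ℝ := fun s => ∑ j ∈ G.neighborFinset i, 1 / ps j * ind s j with hg
  have hmean : bernExp ps Finset.univ g = G.degree i := by
    rw [hg, bernExp_sum_mul_ind (Finset.subset_univ _)]
    have : ∀ j, 1 / ps j * ps j = 1 := fun j => by
      have := (hp j).1.ne'
      field_simp
    simp only [this]
    simp
  have hvar : l * ∑ j, ps j * (1 - ps j) * L j ^ 2 ≤ G.degree i := by
    have : l * ∑ j, ps j * (1 - ps j) * L j ^ 2 ≤
        ∑ j, if j ∈ G.neighborFinset i then (1 : ℝ) else 0 := by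
      rw [Finset.mul_sum]
      refine Finset.sum_le_sum fun j _ => ?_
      simp only [hL]
      split_ifs
      · by_cases hj1 : ps j = 1
        · simp [hj1]
        · have hj := (hp j).1
          have e : l * (ps j * (1 - ps j) * (1 / ps j) ^ 2) = l * (1 / ps j) * (1 - ps j) := by
            field_simp
          rw [e]
          exact mul_le_one₀ (hlp j hj1) (by linarith [hp1 j]) (by linarith [hp1 j])
      · simp
    refine this.trans (le_of_eq ?_)
    rw [Finset.sum_ite_mem, Finset.univ_inter]
    simp
  have hmgf := bernExp_exp_le (I := Finset.univ) hp0 hp1 L hl0.le (fun j _ => by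
      by_cases hj1 : ps j = 1
      · exact Or.inl hj1
      · right
        simp only [hL]
        split_ifs
        · exact hlp j hj1
        · simp) g (fun j _ s hjs => by
      simp only [hg, hL]
      rw [sum_mul_ind_insert_sub hjs]
      split_ifs
      · exact (abs_of_nonneg (one_div_nonneg.2 (hp0 j))).le
      · simp)
  rw [hmean] at hmgf
  have hmarkov : bernExp ps Finset.univ (fun s =>
      if ∑ j ∈ G.neighborFinset i, wStar G ps i j * ind s j ≤ goodBound G ε ps i then 0 else 1) ≤
      bernExp ps Finset.univ (fun s =>
        Real.exp (-(l * (ε * D + 2 * G.degree i))) * Real.exp (l * g s)) := by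
    refine bernExp_mono hp0 hp1 fun s => ?_
    split_ifs with h
    · positivity
    · rw [← Real.exp_add]
      refine Real.one_le_exp ?_
      have e : ∑ j ∈ G.neighborFinset i, wStar G ps i j * ind s j = g s / (ps i * D ^ 2) := by
        rw [hg, Finset.sum_div]
        refine Finset.sum_congr rfl fun j _ => ?_
        have := (hp j).1
        unfold wStar
        rw [← hDdef]
        field_simp
      rw [e, goodBound, ← hDdef, div_le_div_iff_of_pos_right (by positivity), not_le] at h
      nlinarith
  rw [bernExp_const_mul] at hmarkov
  refine hmarkov.trans ((mul_le_mul_of_nonneg_left hmgf (Real.exp_pos _).le).trans ?_)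
  rw [← Real.exp_add, Real.exp_le_exp]
  have e2 : l * (ε * D) = ε ^ 2 / (2 * β) := by
    rw [hl]
    field_simp
  nlinarith [mul_le_mul_of_nonneg_left hvar hl0.le]

open Classical in
/-- The union bound over the vertices. -/
lemma half_le_bernExp_isGood (hε : 0 < ε) (hD : 0 < avgDegree G) (hβ : 0 < β)
    (hn : 2 ≤ n) (hβn : 4 * Real.log n * β ≤ ε ^ 2) (hp : IsSampling G ε β ps) :
    1 / 2 ≤ bernExp ps Finset.univ (fun s => if IsGood G ε ps (ind s) then 1 else 0) := by
  have hp0 : ∀ i, 0 ≤ ps i := fun i => (hp i).1.le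
  have hp1 : ∀ i, ps i ≤ 1 := fun i => (hp i).2.1
  have h : bernExp ps Finset.univ (fun _ => 1) ≤ bernExp ps Finset.univ (fun s =>
      (if IsGood G ε ps (ind s) then 1 else 0) +
        ∑ i, if ∑ j ∈ G.neighborFinset i, wStar G ps i j * ind s j ≤ goodBound G ε ps i
          then 0 else 1) := by
    refine bernExp_mono hp0 hp1 fun s => ?_
    have hnn : ∀ i ∈ Finset.univ, (0 : ℝ) ≤
        if ∑ j ∈ G.neighborFinset i, wStar G ps i j * ind s j ≤ goodBound G ε ps i
          then 0 else 1 := fun i _ => by split_ifs <;> norm_num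
    by_cases hs : IsGood G ε ps (ind s)
    · rw [if_pos hs]
      linarith [Finset.sum_nonneg hnn]
    · rw [if_neg hs, zero_add]
      obtain ⟨i, hi⟩ := not_forall.1 hs
      have h1 := Finset.single_le_sum hnn (Finset.mem_univ i)
      rwa [goodBound, if_neg hi] at h1
  rw [bernExp_add, bernExp_sum, bernExp_const] at h
  have h2 := Finset.sum_le_sum fun i (_ : i ∈ Finset.univ) =>
    bernExp_not_good_at_le hε hD hβ hp i
  simp only [Finset.sum_const, Finset.card_univ, Fintype.card_fin, nsmul_eq_mul] at h2
  have hn0 : (0 : ℝ) < n := by positivity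
  have h3 : Real.exp (-(ε ^ 2 / (2 * β))) ≤ 1 / (n : ℝ) ^ 2 := by
    have e : 1 / (n : ℝ) ^ 2 = Real.exp (-(2 * Real.log n)) := by
      rw [Real.exp_neg, two_mul, Real.exp_add, Real.exp_log hn0]
      ring
    rw [e, Real.exp_le_exp, neg_le_neg_iff, le_div_iff₀ (by positivity)]
    linarith
  have h4 : (n : ℝ) * (1 / (n : ℝ) ^ 2) ≤ 1 / 2 := by
    have : (n : ℝ) * (1 / (n : ℝ) ^ 2) = 1 / n := by field_simp
    rw [this]
    exact one_div_le_one_div_of_le two_pos (by exact_mod_cast hn)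
  have h5 := mul_le_mul_of_nonneg_left h3 hn0.le
  linarith

open Classical in
/-- The tail bound for the quadratic deviation on the good event. -/
lemma bernExp_quadDev_tail_le (hε : 0 < ε) (hε1 : ε ≤ 1) (hD : 0 < avgDegree G) (hβ : 0 < β)
    (hβε : 2048 * β ≤ ε ^ 3) (hp : IsSampling G ε β ps) (hc : ∀ j, 0 ≤ c j ∧ c j ≤ 2)
    (hgood : ∃ s, IsGood G ε ps (ind s)) :
    bernExp ps Finset.univ (fun s => if IsGood G ε ps (ind s) ∧
      ε * n / (8 * avgDegree G) ≤ quadDev G ps c (ind s) then 1 else 0) ≤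
      Real.exp (-(ε ^ 2 * n / (589824 * β * avgDegree G))) := by
  set D := avgDegree G with hDdef
  have hp0 : ∀ i, 0 ≤ ps i := fun i => (hp i).1.le
  have hp1 : ∀ i, ps i ≤ 1 := fun i => (hp i).2.1
  have hpos : ∀ i, 0 < ps i := fun i => (hp i).1
  have hb := goodBound_nonneg hε.le hD.le hpos
  obtain ⟨g, hgle, hgeq, hglip⟩ := exists_lipschitz_minorant
    (Finset.univ.filter fun s => IsGood G ε ps (ind s))
    (by obtain ⟨s, hs⟩ := hgood
        exact ⟨s, by simpa using hs⟩)
    (fun s => quadDev G ps c (ind s))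
    (fun s t => ∑ j, 4 * goodBound G ε ps j * |ind s j - ind t j|)
    (fun s => by simp)
    (fun s t u => by
      rw [← Finset.sum_add_distrib]
      refine Finset.sum_le_sum fun j _ => ?_
      rw [← mul_add]
      exact mul_le_mul_of_nonneg_left (abs_sub_le _ _ _) (mul_nonneg zero_le_four (hb j)))
    (fun t ht s => quadDev_sub_le hε.le hD hpos hc (ind_nonneg s) (ind_nonneg t)
      (Finset.mem_filter.1 ht).2)
  have hdist : ∀ i s, i ∉ s →
      ∑ j, 4 * goodBound G ε ps j * |ind (insert i s) j - ind s j| = 4 * goodBound G ε ps i := by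
    intro i s his
    rw [Finset.sum_eq_single i]
    · simp [ind, his]
    · intro j _ hj
      simp [ind_insert_of_ne hj]
    · simp
  have hdiff : ∀ i ∈ Finset.univ, ∀ s, i ∉ s →
      |g (insert i s) - g s| ≤ 4 * goodBound G ε ps i := by
    intro i _ s his
    have h1 := hglip (insert i s) s
    have h2 := hglip s (insert i s)
    simp only [abs_sub_comm (ind s _), hdist i s his] at h1 h2
    rw [abs_le]
    constructor <;> linarith
  set l := ε / (18432 * β) with hl
  have hl0 : 0 < l := by positivity
  have hmgf := bernExp_exp_le (I := Finset.univ) hp0 hp1 (fun i => 4 * goodBound G ε ps i) hl0.le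
    (fun i _ => by
      by_cases h1 : ps i = 1
      · exact Or.inl h1
      · right
        refine (mul_le_mul_of_nonneg_left (goodBound_le hD hp h1) hl0.le).trans ?_
        rw [hl, div_mul_eq_mul_div, div_le_one (by positivity)]
        nlinarith) g hdiff
  have hmean : bernExp ps Finset.univ g ≤ ε * n / (16 * D) :=
    (bernExp_mono hp0 hp1 hgle).trans (bernExp_quadDev_le hε hD hβ hβε hp hc)
  have hvar := sum_variance_le hε.le hε1 hD hβ hp
  have hmarkov : bernExp ps Finset.univ (fun s => if IsGood G ε ps (ind s) ∧
      ε * n / (8 * D) ≤ quadDev G ps c (ind s) then 1 else 0) ≤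
      bernExp ps Finset.univ (fun s =>
        Real.exp (-(l * (ε * n / (8 * D)))) * Real.exp (l * g s)) := by
    refine bernExp_mono hp0 hp1 fun s => ?_
    split_ifs with h
    · rw [← Real.exp_add]
      refine Real.one_le_exp ?_
      rw [hgeq s (by simpa using h.1)]
      nlinarith [h.2]
    · positivity
  rw [bernExp_const_mul] at hmarkov
  refine hmarkov.trans ((mul_le_mul_of_nonneg_left hmgf (Real.exp_pos _).le).trans ?_)
  rw [← Real.exp_add, Real.exp_le_exp]
  have h1 := mul_le_mul_of_nonneg_left hmean hl0.le
  have h2 := mul_le_mul_of_nonneg_left hvar (sq_nonneg l)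
  -- `l` minimizes the resulting quadratic exponent
  have e : -(l * (ε * n / (8 * D))) + (l * (ε * n / (16 * D)) + l ^ 2 * (576 * β * n / D)) =
      -(ε ^ 2 * n / (589824 * β * D)) := by
    rw [hl]
    field_simp
    ring
  linarith

end Random

/-! ### Passing to the random variables -/

open Classical in
/-- The law of independent Bernoulli variables is a finite sum over their possible supports. -/
lemma measureReal_eq_bernExp {Ω : Type*} [MeasurableSpace Ω] {μ : Measure Ω}
    [IsProbabilityMeasure μ] {Y : Fin n → Ω → ℝ} {ps : Fin n → ℝ} (hY : ∀ i, Measurable (Y i))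
    (hind : iIndepFun Y μ) (h1 : ∀ i, μ.real {ω | Y i ω = 1} = ps i)
    (h0 : ∀ i, μ.real {ω | Y i ω = 0} = 1 - ps i) (Q : (Fin n → ℝ) → Prop) :
    μ.real {ω | Q fun i => Y i ω} =
      bernExp ps Finset.univ (fun s => if Q (ind s) then 1 else 0) := by
  set X : Ω → Finset (Fin n) := fun ω => Finset.univ.filter fun i => Y i ω = 1 with hX
  have hae : ∀ᵐ ω ∂μ, (fun i => Y i ω) = ind (X ω) := by
    have h : ∀ᵐ ω ∂μ, ∀ i, Y i ω = 1 ∨ Y i ω = 0 := by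
      refine ae_all_iff.2 fun i => ?_
      have hm1 : MeasurableSet {ω | Y i ω = 1} := hY i (measurableSet_singleton 1)
      have hm0 : MeasurableSet {ω | Y i ω = 0} := hY i (measurableSet_singleton 0)
      have hu : μ.real ({ω | Y i ω = 1} ∪ {ω | Y i ω = 0}) = 1 := by
        rw [measureReal_union (Set.disjoint_left.2 fun ω hω hω' => by
          simp only [Set.mem_ofPred_eq] at hω hω'
          linarith) hm0, h1, h0]
        ring
      have hc := measureReal_compl (μ := μ) (hm1.union hm0)
      rw [hu, probReal_univ, sub_self, measureReal_eq_zero_iff] at hc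
      exact hc
    filter_upwards [h] with ω hω
    ext i
    rcases hω i with h | h <;> simp [hX, ind, h]
  have hfib : ∀ s, {ω | X ω = s} =
      ⋂ i ∈ Finset.univ, Y i ⁻¹' (if i ∈ s then {1} else {1}ᶜ) := by
    intro s
    ext ω
    simp only [hX, Set.mem_ofPred_eq, Finset.ext_iff, Finset.mem_filter, Finset.mem_univ,
      true_and, Set.mem_iInter, Set.mem_preimage, forall_const]
    refine forall_congr' fun i => ?_
    by_cases hi : i ∈ s <;> simp [hi]
  have hms : ∀ (s : Finset (Fin n)) i,
      MeasurableSet (if i ∈ s then ({1} : Set ℝ) else {1}ᶜ) := fun s i => by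
    split_ifs
    · exact measurableSet_singleton 1
    · exact (measurableSet_singleton 1).compl
  have hfibm : ∀ s, MeasurableSet {ω | X ω = s} := fun s => by
    rw [hfib]
    exact Finset.measurableSet_biInter _ fun i _ => hY i (hms s i)
  have hprob : ∀ s, μ.real {ω | X ω = s} = bernWeight ps Finset.univ s := fun s => by
    rw [hfib, measureReal_def, hind.measure_inter_preimage_eq_mul Finset.univ
      fun i _ => hms s i, ENNReal.toReal_prod]
    refine Finset.prod_congr rfl fun i _ => ?_
    rw [← measureReal_def]
    split_ifs
    · exact h1 i
    · rw [Set.preimage_compl, measureReal_compl (hY i (measurableSet_singleton 1)), probReal_univ]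
      exact congrArg _ (h1 i)
  have hev : μ.real {ω | Q fun i => Y i ω} =
      μ.real (⋃ s ∈ Finset.univ.filter (fun s => Q (ind s)), {ω | X ω = s}) := by
    refine measureReal_congr ?_
    filter_upwards [hae] with ω hω
    refine propext ?_
    change (Q fun i => Y i ω) ↔ ω ∈ ⋃ s ∈ Finset.univ.filter (fun s => Q (ind s)), {ω | X ω = s}
    rw [hω]
    simp
  have hunion := measureReal_biUnion_finset (μ := μ) (s := Finset.univ.filter fun s => Q (ind s))
    (f := fun s => {ω | X ω = s})
    (fun s _ t _ hst => Set.disjoint_left.2 fun ω (hs : X ω = s) (ht : X ω = t) =>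
      hst (hs.symm.trans ht))
    fun s _ => hfibm s
  rw [hev, hunion]
  simp only [hprob, bernExp, Finset.powerset_univ, mul_ite, mul_one, mul_zero, Finset.sum_filter]

/-- Removing the seed probability `q` from the sampling probabilities costs at most a factor of
two, since `q` is at most `16 / C` times every probability that is not one. -/
lemma isSampling_pStar {G : SimpleGraph (Fin n)} [DecidableRel G.Adj] {C ε : ℝ} (hC : 32 ≤ C)
    (hε : 0 < ε) (hε1 : ε ≤ 1) (hD : 0 < avgDegree G) (hq1 : seedProb G ε < 1)
    (hlog : 0 < Real.log n) {p : Fin n → ℝ} (S : Finset (Fin n))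
    (hp : ∀ i, importance G C ε i ≤ p i ∧ p i ≤ 1) :
    IsSampling G ε (alphaParam C ε n) (pStar p (seedProb G ε) S) := by
  intro i
  set D := avgDegree G with hDdef
  have hα : 0 < alphaParam C ε n := by
    unfold alphaParam
    positivity
  have hq0 : 0 < seedProb G ε := by
    unfold seedProb
    positivity
  by_cases hiS : i ∈ S
  · simp [pStar, hiS]
  simp only [pStar, hiS, if_false]
  set q := seedProb G ε with hq
  obtain ⟨h1, h2⟩ := hp i
  have hq1' : 0 < 1 - q := sub_pos.2 hq1
  by_cases hpi : p i = 1
  · rw [hpi, div_self hq1'.ne']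
    exact ⟨one_pos, le_rfl, Or.inl rfl⟩
  set m := max (G.degree i : ℝ) (ε * D) with hm
  have hmp : m / (D ^ 2 * alphaParam C ε n) ≤ p i := by
    rcases min_le_iff.1 h1 with h | h
    · exact absurd (le_antisymm h2 h) hpi
    · exact h
  have hqp : 2 * q ≤ p i := by
    refine le_trans ?_ hmp
    rw [le_div_iff₀ (by positivity)]
    have e : 2 * q * (D ^ 2 * alphaParam C ε n) = 32 * ε ^ 2 * D / C := by
      rw [hq, seedProb, alphaParam, ← hDdef]
      field_simp
      ring
    rw [e, div_le_iff₀ (by linarith)]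
    have h3 : ε * D ≤ m := le_max_right _ _
    have h4 : 0 < ε * D := by positivity
    calc 32 * ε ^ 2 * D = 32 * (ε * (ε * D)) := by ring
      _ ≤ C * (1 * m) := by gcongr
      _ = m * C := by ring
  have hhalf : p i / 2 ≤ (p i - q) / (1 - q) := by
    rw [le_div_iff₀ hq1']
    nlinarith
  have hpos : 0 < p i := by linarith
  refine ⟨by linarith, (div_le_one hq1').2 (by linarith), Or.inr ?_⟩
  rw [div_le_iff₀ (by positivity)] at hmp
  have h5 : 0 < D ^ 2 * alphaParam C ε n := by positivity
  nlinarith [mul_le_mul_of_nonneg_left hhalf h5.le]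

end CoreSet

open CoreSet in
theorem theorem5p5 :
    ∃ C₀ : ℝ, 0 < C₀ ∧ ∀ C : ℝ, C₀ ≤ C →
      ∀ (n : ℕ) (G : SimpleGraph (Fin n)) [DecidableRel G.Adj] (ε : ℝ),
        0 < ε → ε ≤ 1 → 0 < CoreSet.avgDegree G → CoreSet.seedProb G ε < 1 →
      -- the sampling probabilities, the seed set, and the coefficients
      ∀ (p : Fin n → ℝ) (S : Finset (Fin n)) (c : Fin n → ℝ),
        (∀ i, CoreSet.importance G C ε i ≤ p i ∧ p i ≤ 2 * CoreSet.importance G C ε i ∧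
          p i ≤ 1) →
        (∀ j, 0 ≤ c j ∧ c j ≤ 2) →
      -- independent `Y_i`, equal to `1` with probability `p*_i` and to `0` otherwise
      ∀ (Ω : Type*) [MeasurableSpace Ω] (μ : Measure Ω) [IsProbabilityMeasure μ]
        (Y : Fin n → Ω → ℝ),
        (∀ i, Measurable (Y i)) →
        iIndepFun Y μ →
        (∀ i, μ.real {ω | Y i ω = 1} = CoreSet.pStar p (CoreSet.seedProb G ε) S i) →
        (∀ i, μ.real {ω | Y i ω = 0} = 1 - CoreSet.pStar p (CoreSet.seedProb G ε) S i) →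
      0 < μ.real {ω | CoreSet.IsGood G ε (CoreSet.pStar p (CoreSet.seedProb G ε) S)
          (fun i => Y i ω)} ∧
      (μ[|{ω | CoreSet.IsGood G ε (CoreSet.pStar p (CoreSet.seedProb G ε) S)
          (fun i => Y i ω)}]).real
        {ω | ε * n / (8 * CoreSet.avgDegree G) ≤
          CoreSet.quadDev G (CoreSet.pStar p (CoreSet.seedProb G ε) S) c (fun i => Y i ω)} ≤
        1 / (n : ℝ) ^ 5 *
          Real.exp (-(20 * n * Real.log n / (ε ^ 2 * CoreSet.avgDegree G))) := by
  classical
  -- the tail exponent `C / 589824` has to exceed `20 + 5 + 2`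
  refine ⟨2 * 10 ^ 7, by norm_num, fun C hC n G _ ε hε hε1 hD hq1 p S c hp hc Ω _ μ _ Y hY hind
    h1 h0 => ?_⟩
  have hCpos : 0 < C := by linarith
  -- a graph of positive average degree has an edge, hence two vertices
  have hDn : avgDegree G ≤ n ∧ 2 ≤ n := by
    have hn0 : n ≠ 0 := fun h => by simp [avgDegree, h] at hD
    have hn0' : (0 : ℝ) < n := by positivity
    have hdeg : ∀ i, (G.degree i : ℝ) ≤ n - 1 := fun i => by
      have h := G.degree_lt_card_verts i
      rw [Fintype.card_fin] at h
      have h' : (G.degree i : ℝ) + 1 ≤ n := by exact_mod_cast h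
      linarith
    have hle : avgDegree G ≤ n - 1 := by
      rw [avgDegree, div_le_iff₀ hn0']
      refine (Finset.sum_le_sum fun i _ => hdeg i).trans (le_of_eq ?_)
      rw [Finset.sum_const, Finset.card_univ, Fintype.card_fin, nsmul_eq_mul, mul_comm]
    refine ⟨by linarith, ?_⟩
    have : (1 : ℝ) < n := by linarith
    exact_mod_cast this
  obtain ⟨hDn, hn⟩ := hDn
  have hn0 : (0 : ℝ) < n := by positivity
  have hlog2 : 1 / 2 < Real.log n := by
    have h2 : Real.log 2 ≤ Real.log n :=
      Real.log_le_log two_pos (by exact_mod_cast hn)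
    linarith [Real.log_two_gt_d9]
  have hlog : 0 < Real.log n := by linarith
  set β := alphaParam C ε n with hβdef
  have hβ : 0 < β := by
    rw [hβdef, alphaParam]
    positivity
  have hβC : β * (C * Real.log n) = ε ^ 4 := by
    rw [hβdef, alphaParam]
    field_simp
  have hsamp := isSampling_pStar (by linarith) hε hε1 hD hq1 hlog S
    fun i => ⟨(hp i).1, (hp i).2.2⟩
  set ps := pStar p (seedProb G ε) S with hps
  have hε4 : ε ^ 4 ≤ ε ^ 3 := pow_le_pow_of_le_one hε.le hε1 (by norm_num)
  have hε42 : ε ^ 4 ≤ ε ^ 2 := pow_le_pow_of_le_one hε.le hε1 (by norm_num)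
  have hβε : 2048 * β ≤ ε ^ 3 := by
    have : 2048 ≤ C * Real.log n := by nlinarith
    nlinarith
  have hβn : 4 * Real.log n * β ≤ ε ^ 2 := by
    nlinarith [mul_pos hlog hβ]
  have hgood := half_le_bernExp_isGood hε hD hβ hn hβn hsamp
  have hex : ∃ s, IsGood G ε ps (ind s) := by
    by_contra! h
    simp only [h, if_false, bernExp_const] at hgood
    norm_num at hgood
  have hgood' := measureReal_eq_bernExp hY hind h1 h0 (IsGood G ε ps)
  have htail' := measureReal_eq_bernExp hY hind h1 h0
    (fun y => IsGood G ε ps y ∧ ε * n / (8 * avgDegree G) ≤ quadDev G ps c y)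
  rw [← hgood'] at hgood
  -- `congr!` identifies the decidability instances
  have htail := htail'.le.trans ((le_of_eq (by congr!)).trans
    (bernExp_quadDev_tail_le hε hε1 hD hβ hβε hsamp hc hex))
  have hmeas : MeasurableSet {ω | IsGood G ε ps fun i => Y i ω} := by
    simp only [IsGood, Set.ofPred_forall]
    refine MeasurableSet.iInter fun i => measurableSet_le ?_ measurable_const
    exact Finset.measurable_sum _ fun j _ => (hY j).const_mul _
  refine ⟨by linarith, ?_⟩
  rw [measureReal_def, cond_apply hmeas, ENNReal.toReal_mul, ENNReal.toReal_inv]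
  set K := n * Real.log n / (ε ^ 2 * avgDegree G) with hK
  -- `K` dominates `log n`, which pays for the factor `n ^ 5` and for the conditioning
  have hKlog : Real.log n ≤ K := by
    rw [hK, le_div_iff₀ (by positivity)]
    have : ε ^ 2 * avgDegree G ≤ 1 * n := by
      gcongr
      exact pow_le_one₀ hε.le hε1
    nlinarith
  have hexp : ε ^ 2 * n / (589824 * β * avgDegree G) = C / 589824 * K := by
    have : β = ε ^ 4 / (C * Real.log n) := rfl
    rw [hK, this]
    field_simp
  have hn5 : 1 / (n : ℝ) ^ 5 = Real.exp (-(5 * Real.log n)) := by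
    rw [Real.exp_neg, mul_comm, Real.exp_mul, Real.exp_log hn0, one_div]
    norm_cast
  have h20 : 20 * n * Real.log n / (ε ^ 2 * avgDegree G) = 20 * K := by
    rw [hK]
    ring
  rw [hexp] at htail
  rw [hn5, h20, ← Real.exp_add]
  have htwo : (2 : ℝ) ≤ Real.exp (2 * Real.log n) := by
    have := Real.add_one_le_exp (2 * Real.log n)
    linarith
  have hinv : (μ.real {ω | IsGood G ε ps fun i => Y i ω})⁻¹ ≤ Real.exp (2 * Real.log n) := by
    refine (inv_anti₀ (by norm_num) hgood).trans ?_
    simpa using htwo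
  refine (mul_le_mul hinv htail measureReal_nonneg (Real.exp_pos _).le).trans ?_
  rw [← Real.exp_add, Real.exp_le_exp]
  have : 27 * K ≤ C / 589824 * K := by
    have hK0 : 0 ≤ K := by linarith
    gcongr
    rw [le_div_iff₀ (by norm_num)]
    linarith
  linarith
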